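/- Call a closed set $A\subseteq[0,1]$ co-c.e. closed if there is a computable sequence of open balls of the metric space $[0,1]$ with rational centres in $[0,1]$ and rational radii $\ge 0$ (radius $0$ giving the empty ball) whose union is $[0,1]\setminus A$. Call a sequence $(u_n)_{n\in\mathbb N}$ of real numbers computable if there is a computable double sequence of rational numbers $(q_{n,k})_{n,k\in\mathbb N}$ with $|q_{n,k}-u_n|\le 2^{-k}$ for all $n,k$; a real $x$ is an accumulation point of $(u_n)_{n\in\mathbb N}$ if every neighbourhood of $x$ contains $u_n$ for infinitely many indices $n$. There is a non-empty co-c.e. closed set $A\subseteq[0,1]$ with only countably many connectedness components such that some connectedness component $C$ of $A$ is not co-c.e. closed and, moreover, $C$ is not the set of accumulation points of any computable sequence of real numbers. -/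

import Mathlib

open Set Filter Topology

/-- A standard enumeration of the rational numbers (with repetitions): the code `⟨⟨a, b⟩, c⟩`
stands for `(a - b) / (c + 1)`. -/
def ratEnum (n : ℕ) : ℚ :=
  ((n.unpair.1.unpair.1 : ℚ) - (n.unpair.1.unpair.2 : ℚ)) / ((n.unpair.2 : ℚ) + 1)

/-- A standard enumeration of the non-negative rational numbers: the code `⟨a, b⟩` stands for
`a / (b + 1)`. -/
def radiusEnum (n : ℕ) : ℚ :=
  (n.unpair.1 : ℚ) / ((n.unpair.2 : ℚ) + 1)

/-- The real line as a computable metric space: the dense sequence of the rational numbers. -/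
noncomputable def realDense (n : ℕ) : ℝ := (ratEnum n : ℝ)

/-- The unit interval as a computable metric space: the dense sequence of the rational numbers
in `[0,1]` (codes of rationals outside `[0,1]` are read as the nearest endpoint). -/
noncomputable def unitDense (n : ℕ) : Icc (0 : ℝ) 1 :=
  projIcc 0 1 zero_le_one (ratEnum n : ℝ)

section MetricSpaces

variable {X : Type*} [MetricSpace X]

/-- The `n`-th open ball with centre in the dense sequence `α` and rational radius; radius `0`
gives the empty ball. -/
def rationalBall (α : ℕ → X) (n : ℕ) : Set X :=
  Metric.ball (α n.unpair.1) (radiusEnum n.unpair.2 : ℝ)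

/-- The representation of the closed subsets of `X` by negative information: `p` is a name of the
complement of the union of the balls that it lists. -/
def negRep (α : ℕ → X) (p : ℕ → ℕ) : Set X :=
  (⋃ i : ℕ, rationalBall α (p i))ᶜ

/-- A set is co-c.e. closed if it has a computable name with respect to negative information. -/
def IsCoCEClosed (α : ℕ → X) (A : Set X) : Prop :=
  ∃ p : ℕ → ℕ, Computable p ∧ negRep α p = A

/-- A sequence of points is computable if the Cauchy representation has a computable sequence of
names for it: from `n` and `k` one computes an index of a point of the dense sequence within
distance `2 ^ (-k)` of `u n`. -/
def IsComputableSeq (α : ℕ → X) (u : ℕ → X) : Prop :=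
  ∃ f : ℕ → ℕ → ℕ, Computable₂ f ∧ ∀ n k : ℕ, dist (α (f n k)) (u n) ≤ (1 / 2 : ℝ) ^ k

/-- The accumulation points of a sequence: every neighbourhood contains infinitely many terms
(counted with their indices), i.e. the limits of subsequences. -/
def accumulationPoints (u : ℕ → X) : Set X :=
  {x | MapClusterPt x atTop u}

/-- The connectedness components of a subset `A`. -/
def connectednessComponents (A : Set X) : Set (Set X) :=
  {C | ∃ x ∈ A, C = connectedComponentIn A x}

end MetricSpaces

/-! The set `A` consists of one irrational point `x` and some rationals, so it is countable and its
components are singletons; the bad component is `{x}`. Points carry dyadic addresses, and `A` is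
what remains after removing the intervals of all inadmissible finite sequences. An irrational point
of `A` has an infinite address whose initial segments are all admissible, and exactly one sequence
`X` has this property (`exists_consistent`, `eq_of_consistent`). Its entries carry halting times as
witnesses, so purely local checks force the entry at `⟨e, 0⟩` to answer a `Π₂` question: does
program `e` halt on `⟨m, e⟩` for every `m ≥ 1`?

If `{x}` were co-c.e. closed, or the accumulation set of a computable sequence, compactness would
make `x ∈ cyl σ` a `Σ₂` condition on `σ`, and with it that question
(`not_exists_computable_approximation`). Diagonalisation rules this out (`not_sigmaTwo_rows`). -/

/-! ### Closure properties of computable functions and decidable predicates -/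

section ComputabilityToolkit

variable {α β : Type*} [Primcodable α] [Primcodable β]

theorem Computable.add_fun {f g : α → ℕ} (hf : Computable f) (hg : Computable g) :
    Computable fun a => f a + g a :=
  Primrec.nat_add.to_comp.comp hf hg

theorem Computable.sub_fun {f g : α → ℕ} (hf : Computable f) (hg : Computable g) :
    Computable fun a => f a - g a :=
  Primrec.nat_sub.to_comp.comp hf hg

theorem Computable.mul_fun {f g : α → ℕ} (hf : Computable f) (hg : Computable g) :
    Computable fun a => f a * g a :=
  Primrec.nat_mul.to_comp.comp hf hg

theorem Computable.min_fun {f g : α → ℕ} (hf : Computable f) (hg : Computable g) :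
    Computable fun a => min (f a) (g a) :=
  Primrec.nat_min.to_comp.comp hf hg

theorem Computable.pow_fun {f g : α → ℕ} (hf : Computable f) (hg : Computable g) :
    Computable fun a => f a ^ g a :=
  (Primrec₂.unpaired'.1 Nat.Primrec.pow).to_comp.comp hf hg

theorem Computable.natPair_fun {f g : α → ℕ} (hf : Computable f) (hg : Computable g) :
    Computable fun a => Nat.pair (f a) (g a) :=
  Primrec₂.natPair.to_comp.comp hf hg

theorem Computable.unpair_fst {f : α → ℕ} (hf : Computable f) :
    Computable fun a => (f a).unpair.1 :=
  Computable.fst.comp (Computable.unpair.comp hf)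

theorem Computable.unpair_snd {f : α → ℕ} (hf : Computable f) :
    Computable fun a => (f a).unpair.2 :=
  Computable.snd.comp (Computable.unpair.comp hf)

theorem Computable.getD_fun {f : α → List ℕ} {g : α → ℕ} (hf : Computable f)
    (hg : Computable g) : Computable fun a => (f a).getD (g a) 0 :=
  (Primrec.list_getD 0).to_comp.comp hf hg

theorem PrimrecRel.computablePred_comp {γ : Type*} [Primcodable γ] {R : β → γ → Prop}
    (hR : PrimrecRel R) {f : α → β} {g : α → γ} (hf : Computable f) (hg : Computable g) :
    ComputablePred fun a => R (f a) (g a) := by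
  classical
  exact ⟨Classical.decPred _, (hR.decide.to_comp.comp hf hg).of_eq fun a => by congr⟩

theorem ComputablePred.lt {f g : α → ℕ} (hf : Computable f) (hg : Computable g) :
    ComputablePred fun a => f a < g a :=
  Primrec.nat_lt.computablePred_comp hf hg

theorem ComputablePred.le {f g : α → ℕ} (hf : Computable f) (hg : Computable g) :
    ComputablePred fun a => f a ≤ g a :=
  Primrec.nat_le.computablePred_comp hf hg

theorem ComputablePred.eq {f g : α → ℕ} (hf : Computable f) (hg : Computable g) :
    ComputablePred fun a => f a = g a :=
  Primrec.eq.computablePred_comp hf hg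

theorem ComputablePred.and {p q : α → Prop} (hp : ComputablePred p) (hq : ComputablePred q) :
    ComputablePred fun a => p a ∧ q a := by
  obtain ⟨_, hp⟩ := hp
  obtain ⟨_, hq⟩ := hq
  exact ⟨inferInstance, (Primrec.and.to_comp.comp hp hq).of_eq fun a => by simp⟩

theorem ComputablePred.imp {p q : α → Prop} (hp : ComputablePred p) (hq : ComputablePred q) :
    ComputablePred fun a => p a → q a :=
  (hp.and hq.not).not.of_eq fun a => by tauto

theorem ComputablePred.comp {p : β → Prop} {f : α → β} (hp : ComputablePred p)
    (hf : Computable f) : ComputablePred fun a => p (f a) := by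
  obtain ⟨_, hp⟩ := hp
  exact ⟨inferInstance, hp.comp hf⟩

theorem ComputablePred.forall_lt {p : α → ℕ → Prop} {f : α → ℕ}
    (hp : ComputablePred fun a : α × ℕ => p a.1 a.2) (hf : Computable f) :
    ComputablePred fun a => ∀ i < f a, p a i := by
  classical
  obtain ⟨_, hp⟩ := hp
  replace hp : Computable fun a : α × ℕ => @decide (p a.1 a.2) (Classical.propDecidable _) :=
    hp.of_eq fun a => by congr
  have h : Computable fun a => Nat.rec (motive := fun _ => Bool) true
      (fun i b => b && decide (p a i)) (f a) := by
    refine Computable.nat_rec hf (Computable.const true)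
      (h := fun a s => s.2 && decide (p a s.1)) ?_
    exact Primrec.and.to_comp.comp (Computable.snd.comp Computable.snd)
      (hp.comp (Computable.pair Computable.fst (Computable.fst.comp Computable.snd)))
  refine ⟨Classical.decPred _, h.of_eq fun a => ?_⟩
  refine Bool.eq_iff_iff.2 (Iff.trans ?_ (@decide_eq_true_iff _ (_)).symm)
  show _ ↔ ∀ i < f a, p a i
  induction f a with
  | zero => simp
  | succ n ih => simp [ih, le_iff_lt_or_eq, or_imp, forall_and]

theorem ComputablePred.ite_fun {p : α → Prop} [DecidablePred p] {f g : α → β}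
    (hp : ComputablePred p)
    (hf : Computable f) (hg : Computable g) : Computable fun a => if p a then f a else g a := by
  obtain ⟨_, hp⟩ := hp
  exact (hp.cond hf hg).of_eq fun a => by by_cases h : p a <;> simp [h]

end ComputabilityToolkit

/-! ### Dyadic addresses of points -/

/-- One step of the dyadic addressing: the `n`-th child of the interval
`(c / 2 ^ k, (c + 1) / 2 ^ k)` of length `L` is the interval of length `L / 2 ^ (n + 1)` that
starts at distance `L / 2 ^ (n + 1)` from the left endpoint. -/
def cylStep (s : ℕ × ℕ) (n : ℕ) : ℕ × ℕ := (s.1 * 2 ^ (n + 1) + 1, s.2 + (n + 1))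

/-- The pair `(c, k)` that describes the dyadic interval addressed by a finite sequence. -/
def cylCode (σ : List ℕ) : ℕ × ℕ := σ.foldl cylStep (0, 0)

/-- The open dyadic interval addressed by a finite sequence. -/
def cyl (σ : List ℕ) : Set ℝ :=
  {z | ((cylCode σ).1 : ℝ) < z * 2 ^ (cylCode σ).2 ∧
    z * 2 ^ (cylCode σ).2 < (cylCode σ).1 + 1}

/-- The initial segment of length `j` of a sequence. -/
def initSeg (X : ℕ → ℕ) (j : ℕ) : List ℕ := (List.range j).map X

theorem initSeg_succ (X : ℕ → ℕ) (j : ℕ) : initSeg X (j + 1) = initSeg X j ++ [X j] := by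
  simp [initSeg, List.range_succ]

@[simp] theorem length_initSeg (X : ℕ → ℕ) (j : ℕ) : (initSeg X j).length = j := by
  simp [initSeg]

theorem getD_initSeg (X : ℕ → ℕ) {i j : ℕ} (h : i < j) : (initSeg X j).getD i 0 = X i := by
  simp [initSeg, List.getD_eq_getElem?_getD, h]

theorem computable_cylCode : Computable cylCode := by
  have : Primrec cylCode := by
    refine Primrec.list_foldl Primrec.id (Primrec.const (0, 0)) (h := fun _ s => cylStep s.1 s.2) ?_
    have hs : Primrec fun a : List ℕ × ((ℕ × ℕ) × ℕ) => a.2.1 :=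
      Primrec.fst.comp Primrec.snd
    have hn : Primrec fun a : List ℕ × ((ℕ × ℕ) × ℕ) => a.2.2 + 1 :=
      Primrec.succ.comp (Primrec.snd.comp Primrec.snd)
    exact Primrec.pair
      (Primrec.succ.comp (Primrec.nat_mul.comp (Primrec.fst.comp hs)
        ((Primrec₂.unpaired'.1 Nat.Primrec.pow).comp (Primrec.const 2) hn)))
      (Primrec.nat_add.comp (Primrec.snd.comp hs) hn)
  exact this.to_comp

theorem cylCode_concat (σ : List ℕ) (n : ℕ) : cylCode (σ ++ [n]) = cylStep (cylCode σ) n := by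
  simp [cylCode]

theorem cyl_nil : cyl [] = Ioo 0 1 := by
  ext z; simp [cyl, cylCode]

theorem isOpen_cyl (σ : List ℕ) : IsOpen (cyl σ) := by
  rw [cyl, ofPred_and]
  exact (isOpen_lt (by fun_prop) (by fun_prop)).inter (isOpen_lt (by fun_prop) (by fun_prop))

/-- In the coordinate that turns the parent into `(0, 1)`, the children are the disjoint intervals
`(2 ^ (-(n + 1)), 2 ^ (-n))`. -/
theorem mem_cyl_concat {z : ℝ} {σ : List ℕ} {n : ℕ} :
    z ∈ cyl (σ ++ [n]) ↔
      1 < (z * 2 ^ (cylCode σ).2 - (cylCode σ).1) * 2 ^ (n + 1) ∧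
      (z * 2 ^ (cylCode σ).2 - (cylCode σ).1) * 2 ^ (n + 1) < 2 := by
  simp only [cyl, cylCode_concat, cylStep, mem_ofPred_eq, pow_add (2 : ℝ) (cylCode σ).2]
  push_cast
  constructor <;> rintro ⟨h₁, h₂⟩ <;> constructor <;> linarith

theorem cyl_concat_subset (σ : List ℕ) (n : ℕ) : cyl (σ ++ [n]) ⊆ cyl σ := by
  intro z hz
  rw [mem_cyl_concat] at hz
  have h2 : (2 : ℝ) ≤ 2 ^ (n + 1) := by
    rw [pow_succ]; linarith [one_le_pow₀ (n := n) (one_le_two (α := ℝ))]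
  constructor
  · by_contra h
    nlinarith
  · by_contra h
    nlinarith

theorem cyl_concat_inj {z : ℝ} {σ : List ℕ} {m n : ℕ} (hm : z ∈ cyl (σ ++ [m]))
    (hn : z ∈ cyl (σ ++ [n])) : m = n := by
  rw [mem_cyl_concat] at hm hn
  set y := z * 2 ^ (cylCode σ).2 - (cylCode σ).1
  have key : ∀ {m n : ℕ}, y * 2 ^ (n + 1) < 2 → 1 < y * 2 ^ (m + 1) → n ≤ m := by
    intro m n h₁ h₂
    by_contra! hlt
    have h3 : (2 : ℝ) ^ (m + 1 + 1) ≤ 2 ^ (n + 1) := pow_le_pow_right₀ one_le_two (by omega)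
    have hy : 0 < y := by
      by_contra! hy
      nlinarith [pow_pos (two_pos (α := ℝ)) (m + 1)]
    rw [pow_succ] at h3
    nlinarith
  exact le_antisymm (key hm.2 hn.1) (key hn.2 hm.1)

theorem eq_of_mem_cyl {z : ℝ} {σ : List ℕ} : ∀ {τ : List ℕ}, σ.length = τ.length →
    z ∈ cyl σ → z ∈ cyl τ → σ = τ := by
  induction σ using List.reverseRecOn with
  | nil => intro τ h _ _; exact (List.length_eq_zero_iff.1 h.symm).symm
  | append_singleton σ m ih =>
    intro τ h hσ hτ
    rcases List.eq_nil_or_concat τ with rfl | ⟨τ, n, hn⟩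
    · simp at h
    · rw [List.concat_eq_append] at hn
      subst hn
      have : σ = τ := ih (by simpa using h) (cyl_concat_subset _ _ hσ) (cyl_concat_subset _ _ hτ)
      subst this
      rw [cyl_concat_inj hσ hτ]

theorem length_le_cylCode (σ : List ℕ) : σ.length ≤ (cylCode σ).2 := by
  induction σ using List.reverseRecOn with
  | nil => simp
  | append_singleton σ m ih => rw [cylCode_concat]; simp [cylStep]; omega

theorem abs_sub_lt_of_mem_cyl {z w : ℝ} {σ : List ℕ} (hz : z ∈ cyl σ) (hw : w ∈ cyl σ) :
    |z - w| < (1 / 2) ^ σ.length := by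
  have h1 : |z - w| * 2 ^ (cylCode σ).2 < 1 := by
    rw [← abs_of_pos (pow_pos (two_pos (α := ℝ)) (cylCode σ).2), ← abs_mul, abs_lt]
    constructor <;> linarith [hz.1, hz.2, hw.1, hw.2]
  have h2 : (2 : ℝ) ^ σ.length ≤ 2 ^ (cylCode σ).2 :=
    pow_le_pow_right₀ one_le_two (length_le_cylCode σ)
  rw [one_div, inv_pow, ← one_div, lt_div_iff₀ (by positivity)]
  nlinarith [abs_nonneg (z - w)]

/-- The children miss only the relative positions `2 ^ (-n)` of the parent, which are rational
points. The right child is found from the least `m` with `1 < y * 2 ^ m`. -/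
theorem exists_mem_cyl_concat {z : ℝ} (hz : Irrational z) {σ : List ℕ} (h : z ∈ cyl σ) :
    ∃ n, z ∈ cyl (σ ++ [n]) := by
  simp only [mem_cyl_concat]
  set y := z * 2 ^ (cylCode σ).2 - (cylCode σ).1 with hy
  have hy0 : 0 < y := by linarith [h.1]
  have hy1 : y < 1 := by linarith [h.2]
  have hex : ∃ m : ℕ, 1 < y * 2 ^ m := by
    obtain ⟨m, hm⟩ := pow_unbounded_of_one_lt (1 / y) one_lt_two
    exact ⟨m, by rwa [div_lt_iff₀' hy0] at hm⟩
  classical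
  obtain ⟨hm, hmin⟩ : 1 < y * 2 ^ Nat.find hex ∧ ∀ l < Nat.find hex, ¬ 1 < y * 2 ^ l :=
    ⟨Nat.find_spec hex, fun l => Nat.find_min hex⟩
  generalize Nat.find hex = m at hm hmin
  cases m with
  | zero => simp at hm; linarith
  | succ n =>
    refine ⟨n, hm, ?_⟩
    have h1 := not_lt.1 (hmin n (Nat.lt_succ_self n))
    have h2 : y * 2 ^ n ≠ 1 := by
      intro h2
      refine hz ⟨((1 / 2 ^ n + (cylCode σ).1) / 2 ^ (cylCode σ).2 : ℚ), ?_⟩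
      have : y = 1 / 2 ^ n := by field_simp; exact h2
      push_cast
      rw [← this, hy]
      field_simp
      ring
    have h3 := lt_of_le_of_ne h1 h2
    rw [pow_succ]
    linarith

theorem exists_path {z : ℝ} (hz : Irrational z) (h : z ∈ Ioo (0 : ℝ) 1) :
    ∃ X : ℕ → ℕ, ∀ j, z ∈ cyl (initSeg X j) := by
  choose! f hf using fun (σ : List ℕ) (h : z ∈ cyl σ) => exists_mem_cyl_concat hz h
  let s : ℕ → List ℕ := fun j => Nat.rec [] (fun _ σ => σ ++ [f σ]) j
  have hs : ∀ j, initSeg (fun i => f (s i)) j = s j := by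
    intro j
    induction j with
    | zero => rfl
    | succ j ih => rw [initSeg_succ, ih]
  refine ⟨fun i => f (s i), fun j => ?_⟩
  rw [hs]
  induction j with
  | zero => exact cyl_nil ▸ h
  | succ j ih => exact hf _ ih

/-- A sequence of positive numbers addresses a point that lies in all the open intervals. -/
theorem exists_forall_mem_cyl {X : ℕ → ℕ} (hX : ∀ i, 1 ≤ X i) :
    ∃ x : ℝ, ∀ j, x ∈ cyl (initSeg X j) := by
  let c : ℕ → ℝ := fun j => (cylCode (initSeg X j)).1
  let k : ℕ → ℕ := fun j => (cylCode (initSeg X j)).2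
  have hc : ∀ j, c (j + 1) = c j * 2 ^ (X j + 1) + 1 := by
    intro j; simp [c, initSeg_succ, cylCode_concat, cylStep]
  have hk : ∀ j, k (j + 1) = k j + (X j + 1) := by
    intro j; simp [k, initSeg_succ, cylCode_concat, cylStep]
  have hpow : ∀ j, (2 : ℝ) ^ k (j + 1) = 2 ^ k j * 2 ^ (X j + 1) := fun j => by rw [hk, pow_add]
  -- Positivity enters here: child `0` shares its right endpoint with the parent, while all others
  -- have closure inside the open parent.
  have h4 : ∀ j, (4 : ℝ) ≤ 2 ^ (X j + 1) := fun j => by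
    calc (4 : ℝ) = 2 ^ 2 := by norm_num
      _ ≤ _ := pow_le_pow_right₀ one_le_two (by have := hX j; omega)
  let a : ℕ → ℝ := fun j => c j / 2 ^ k j
  let b : ℕ → ℝ := fun j => (c j + 1) / 2 ^ k j
  have ha : StrictMono a := strictMono_nat_of_lt_succ fun j => by
    simp only [a]
    rw [div_lt_div_iff₀ (by positivity) (by positivity), hpow, hc]
    nlinarith [pow_pos (two_pos (α := ℝ)) (k j)]
  have hb : StrictAnti b := strictAnti_nat_of_succ_lt fun j => by
    simp only [b]
    rw [div_lt_div_iff₀ (by positivity) (by positivity), hpow, hc]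
    have := h4 j
    have hp := pow_pos (two_pos (α := ℝ)) (k j)
    have : 0 < 2 ^ k j * ((2 : ℝ) ^ (X j + 1) - 2) := mul_pos hp (by linarith)
    nlinarith
  have hx := ha.monotone.ciSup_mem_iInter_Icc_of_antitone hb.antitone fun j => by
    simp only [a, b]; gcongr; linarith
  simp only [mem_iInter, mem_Icc] at hx
  refine ⟨⨆ j, a j, fun j => ⟨?_, ?_⟩⟩
  · have := (ha j.lt_succ_self).trans_le (hx (j + 1)).1
    rwa [div_lt_iff₀ (by positivity)] at this
  · have := (hx (j + 1)).2.trans_lt (hb j.lt_succ_self)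
    rwa [lt_div_iff₀ (by positivity)] at this

theorem eq_of_forall_mem_cyl {X : ℕ → ℕ} {z w : ℝ} (hz : ∀ j, z ∈ cyl (initSeg X j))
    (hw : ∀ j, w ∈ cyl (initSeg X j)) : z = w := by
  by_contra hne
  obtain ⟨n, hn⟩ := exists_pow_lt_of_lt_one (abs_pos.2 (sub_ne_zero.2 hne))
    (one_half_lt_one (α := ℝ))
  have := abs_sub_lt_of_mem_cyl (hz n) (hw n)
  rw [length_initSeg] at this
  exact lt_asymm hn this

/-- A point addressed by an infinite sequence lies in each open interval whose closure
contains it. -/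
theorem mem_cyl_of_mem_closure {X : ℕ → ℕ} {x : ℝ} (hx : ∀ j, x ∈ cyl (initSeg X j))
    {σ : List ℕ} (h : x ∈ closure (cyl σ)) : x ∈ cyl σ := by
  have hl : IsClosed {z : ℝ | ((cylCode σ).1 : ℝ) ≤ z * 2 ^ (cylCode σ).2} :=
    isClosed_le (by fun_prop) (by fun_prop)
  have hr : IsClosed {z : ℝ | z * 2 ^ (cylCode σ).2 ≤ (cylCode σ).1 + 1} :=
    isClosed_le (by fun_prop) (by fun_prop)
  have hcl : x ∈ {z : ℝ | ((cylCode σ).1 : ℝ) ≤ z * 2 ^ (cylCode σ).2} ∩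
      {z | z * 2 ^ (cylCode σ).2 ≤ (cylCode σ).1 + 1} :=
    closure_minimal (fun z hz => And.intro (le_of_lt (And.left hz)) (le_of_lt (And.right hz)))
      (hl.inter hr) h
  -- `x` is not dyadic: deep enough in its address, the scaled `x` would be an integer strictly
  -- between two consecutive integers.
  have hne : ∀ d : ℕ, x * 2 ^ (cylCode σ).2 ≠ d := by
    intro d hd
    obtain ⟨h1, h2⟩ := hx (cylCode σ).2
    have hle := length_le_cylCode (initSeg X (cylCode σ).2)
    rw [length_initSeg] at hle
    obtain ⟨l, hl⟩ := Nat.exists_eq_add_of_le hle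
    rw [hl, pow_add, ← mul_assoc, hd] at h1 h2
    norm_cast at h1 h2
    omega
  refine ⟨lt_of_le_of_ne hcl.1 (hne _).symm, lt_of_le_of_ne hcl.2 ?_⟩
  exact_mod_cast hne ((cylCode σ).1 + 1)

/-! ### Halting times and local consistency -/

open Nat.Partrec (Code)

/-- The program with number `e` halts on the input `⟨m, e⟩` within `s` steps. -/
def HaltsWithin (e m s : ℕ) : Prop :=
  (Code.evaln s (Denumerable.ofNat Code e) (Nat.pair m e)).isSome = true

theorem exists_haltsWithin_iff {e m : ℕ} :
    (∃ s, HaltsWithin e m s) ↔ (Code.eval (Denumerable.ofNat Code e) (Nat.pair m e)).Dom := by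
  simp only [HaltsWithin, Option.isSome_iff_exists, Part.dom_iff_mem, Code.evaln_complete,
    Option.mem_def]
  exact exists_comm

theorem computablePred_haltsWithin {α : Type*} [Primcodable α] {f g h : α → ℕ}
    (hf : Computable f) (hg : Computable g) (hh : Computable h) :
    ComputablePred fun a => HaltsWithin (f a) (g a) (h a) := by
  have : Computable fun a =>
      (Code.evaln (h a) (Denumerable.ofNat Code (f a)) (Nat.pair (g a) (f a))).isSome :=
    Primrec.option_isSome.to_comp.comp (Code.primrec_evaln.to_comp.comp
      ((hh.pair ((Computable.ofNat Code).comp hf)).pair (hg.natPair_fun hf)))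
  exact ComputablePred.computable_iff.2 ⟨_, this, rfl⟩

/-- The local consistency conditions that single out one sequence `X`. For `1 ≤ m` the value at
`⟨e, m⟩` is `1` if the program `e` diverges on `⟨m, e⟩`, and `s + 2` if it halts after exactly `s`
steps; the value at `⟨e, 0⟩` is `1` if there is no divergence, and `m + 1` if the least divergence
is at `m`. Here `v` and `w` are the values at `i` and `j`. -/
def Consistent (i j v w : ℕ) : Prop :=
  1 ≤ v ∧
  (i.unpair.2 = 0 → j.unpair.1 = i.unpair.1 → 1 ≤ j.unpair.2 →
    (v = 1 → ¬ w = 1) ∧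
    (2 ≤ v → (j.unpair.2 = v - 1 → w = 1) ∧ (j.unpair.2 < v - 1 → ¬ w = 1))) ∧
  (1 ≤ i.unpair.2 →
    (v = 1 → ¬ HaltsWithin i.unpair.1 i.unpair.2 j) ∧
    (2 ≤ v → HaltsWithin i.unpair.1 i.unpair.2 (v - 2) ∧
      (j < v - 2 → ¬ HaltsWithin i.unpair.1 i.unpair.2 j)))

theorem computablePred_consistent {α : Type*} [Primcodable α] {f g h k : α → ℕ}
    (hf : Computable f) (hg : Computable g) (hh : Computable h) (hk : Computable k) :
    ComputablePred fun a => Consistent (f a) (g a) (h a) (k a) := by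
  have c (n : ℕ) : Computable fun _ : α => n := Computable.const n
  have f1 := hf.unpair_fst
  have f2 := hf.unpair_snd
  have g2 := hg.unpair_snd
  have k1 := (ComputablePred.eq hk (c 1)).not
  refine (ComputablePred.le (c 1) hh).and (.and ?_ ?_)
  · exact (ComputablePred.eq f2 (c 0)).imp <| (ComputablePred.eq hg.unpair_fst f1).imp <|
      (ComputablePred.le (c 1) g2).imp <| ((ComputablePred.eq hh (c 1)).imp k1).and <|
      (ComputablePred.le (c 2) hh).imp <|
      ((ComputablePred.eq g2 (hh.sub_fun (c 1))).imp (ComputablePred.eq hk (c 1))).and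
      ((ComputablePred.lt g2 (hh.sub_fun (c 1))).imp k1)
  · exact (ComputablePred.le (c 1) f2).imp <|
      ((ComputablePred.eq hh (c 1)).imp (computablePred_haltsWithin f1 f2 hg).not).and <|
      (ComputablePred.le (c 2) hh).imp <|
      (computablePred_haltsWithin f1 f2 (hh.sub_fun (c 2))).and <|
      (ComputablePred.lt hg (hh.sub_fun (c 2))).imp (computablePred_haltsWithin f1 f2 hg).not

/-- A finite sequence is admissible if no inconsistency is visible in it. -/
def Admissible (σ : List ℕ) : Prop :=
  ∀ i < σ.length, ∀ j < σ.length, Consistent i j (σ.getD i 0) (σ.getD j 0)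

theorem computablePred_admissible : ComputablePred Admissible := by
  refine ComputablePred.forall_lt (p := fun σ i => ∀ j < σ.length,
    Consistent i j (σ.getD i 0) (σ.getD j 0)) ?_ Computable.list_length
  refine ComputablePred.forall_lt (p := fun a j =>
    Consistent a.2 j (a.1.getD a.2 0) (a.1.getD j 0)) ?_ (Computable.list_length.comp Computable.fst)
  have hσ : Computable fun a : (List ℕ × ℕ) × ℕ => a.1.1 := Computable.fst.comp Computable.fst
  have hi : Computable fun a : (List ℕ × ℕ) × ℕ => a.1.2 := Computable.snd.comp Computable.fst
  exact computablePred_consistent hi Computable.snd (hσ.getD_fun hi) (hσ.getD_fun Computable.snd)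

/-- Each condition involves two entries only, so a violation is visible in a finite initial segment.
-/
theorem forall_admissible_iff {X : ℕ → ℕ} :
    (∀ n, Admissible (initSeg X n)) ↔ ∀ i j, Consistent i j (X i) (X j) := by
  constructor
  · intro h i j
    have := h (max i j + 1) i (by simp) j (by simp)
    rwa [getD_initSeg X (by omega), getD_initSeg X (by omega)] at this
  · intro h n i hi j hj
    rw [length_initSeg] at hi hj
    rw [getD_initSeg X hi, getD_initSeg X hj]
    exact h i j

/-! ### Existence and uniqueness of the consistent sequence -/

section Unique

variable {X : ℕ → ℕ}

theorem eq_one_iff_of_consistent (h : ∀ i j, Consistent i j (X i) (X j)) {e m : ℕ} (hm : 1 ≤ m) :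
    X (Nat.pair e m) = 1 ↔ ∀ s, ¬ HaltsWithin e m s := by
  have h' := fun j => (h (Nat.pair e m) j).2.2
  have h1 := (h (Nat.pair e m) 0).1
  simp only [Nat.unpair_pair] at h'
  constructor
  · exact fun hX s => (h' s hm).1 hX
  · intro hs
    by_contra hne
    exact hs _ ((h' 0 hm).2 (by omega)).1

theorem row_eq_one_iff_of_consistent (h : ∀ i j, Consistent i j (X i) (X j)) {e : ℕ} :
    X (Nat.pair e 0) = 1 ↔ ∀ m, 1 ≤ m → ∃ s, HaltsWithin e m s := by
  have h1 := (h (Nat.pair e 0) 0).1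
  have h' := fun m => (h (Nat.pair e 0) (Nat.pair e m)).2.1
  simp only [Nat.unpair_pair, true_imp_iff] at h'
  constructor
  · intro hX m hm
    have := (h' m hm).1 hX
    rw [eq_one_iff_of_consistent h hm] at this
    simpa using this
  · intro hs
    by_contra hne
    have := ((h' (X (Nat.pair e 0) - 1) (by omega)).2 (by omega)).1 rfl
    rw [eq_one_iff_of_consistent h (by omega)] at this
    obtain ⟨s, hs⟩ := hs (X (Nat.pair e 0) - 1) (by omega)
    exact this s hs

/-- An entry other than `1` names a least witness. If two such entries differed, the witness named
by the smaller would contradict the minimality claimed by the larger. -/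
theorem eq_of_consistent {Y : ℕ → ℕ} (hX : ∀ i j, Consistent i j (X i) (X j))
    (hY : ∀ i j, Consistent i j (Y i) (Y j)) : X = Y := by
  have hpos : ∀ e m, 1 ≤ m → X (Nat.pair e m) = Y (Nat.pair e m) := by
    intro e m hm
    have h1 : X (Nat.pair e m) = 1 ↔ Y (Nat.pair e m) = 1 := by
      rw [eq_one_iff_of_consistent hX hm, eq_one_iff_of_consistent hY hm]
    have hX1 := (hX (Nat.pair e m) 0).1
    have hY1 := (hY (Nat.pair e m) 0).1
    have hX' := fun j => (hX (Nat.pair e m) j).2.2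
    have hY' := fun j => (hY (Nat.pair e m) j).2.2
    simp only [Nat.unpair_pair] at hX' hY'
    by_cases hv : X (Nat.pair e m) = 1
    · rw [hv, h1.1 hv]
    · have hX2 := fun j => (hX' j hm).2 (by omega)
      have hY2 := fun j => (hY' j hm).2 (by omega)
      rcases lt_trichotomy (X (Nat.pair e m)) (Y (Nat.pair e m)) with hlt | heq | hlt
      · exact absurd (hX2 0).1 ((hY2 _).2 (by omega))
      · exact heq
      · exact absurd (hY2 0).1 ((hX2 _).2 (by omega))
  have hzero : ∀ e, X (Nat.pair e 0) = Y (Nat.pair e 0) := by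
    intro e
    have h1 : X (Nat.pair e 0) = 1 ↔ Y (Nat.pair e 0) = 1 := by
      rw [row_eq_one_iff_of_consistent hX, row_eq_one_iff_of_consistent hY]
    have hX1 := (hX (Nat.pair e 0) 0).1
    have hY1 := (hY (Nat.pair e 0) 0).1
    have hX' := fun m => (hX (Nat.pair e 0) (Nat.pair e m)).2.1
    have hY' := fun m => (hY (Nat.pair e 0) (Nat.pair e m)).2.1
    simp only [Nat.unpair_pair, true_imp_iff] at hX' hY'
    by_cases hv : X (Nat.pair e 0) = 1
    · rw [hv, h1.1 hv]
    · have hX2 := fun m hm => (hX' m hm).2 (by omega)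
      have hY2 := fun m hm => (hY' m hm).2 (by omega)
      rcases lt_trichotomy (X (Nat.pair e 0)) (Y (Nat.pair e 0)) with hlt | heq | hlt
      · exact absurd ((hpos _ _ (by omega)).symm.trans ((hX2 (X (Nat.pair e 0) - 1) (by omega)).1 rfl))
          ((hY2 (X (Nat.pair e 0) - 1) (by omega)).2 (by omega))
      · exact heq
      · exact absurd ((hpos _ _ (by omega)).trans ((hY2 (Y (Nat.pair e 0) - 1) (by omega)).1 rfl))
          ((hX2 (Y (Nat.pair e 0) - 1) (by omega)).2 (by omega))
  funext i
  rw [← Nat.pair_unpair i]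
  rcases Nat.eq_zero_or_pos i.unpair.2 with h | h
  · rw [h, hzero]
  · exact hpos _ _ h

theorem exists_consistent : ∃ X : ℕ → ℕ, ∀ i j, Consistent i j (X i) (X j) := by
  classical
  let T : ℕ → ℕ → ℕ := fun e m =>
    if h : ∃ s, HaltsWithin e m s then Nat.find h + 2 else 1
  -- Since `m ≥ 1`, the value `m + 1` never collides with the default `1`.
  let R : ℕ → ℕ := fun e => if h : ∃ m, 1 ≤ m ∧ T e m = 1 then Nat.find h + 1 else 1
  let X : ℕ → ℕ := fun i => if i.unpair.2 = 0 then R i.unpair.1 else T i.unpair.1 i.unpair.2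
  have hR : ∀ e, 1 ≤ R e ∧ (R e = 1 → ∀ m, 1 ≤ m → T e m ≠ 1) ∧
      (2 ≤ R e → T e (R e - 1) = 1 ∧ ∀ m, 1 ≤ m → m < R e - 1 → T e m ≠ 1) := by
    intro e
    by_cases h : ∃ m, 1 ≤ m ∧ T e m = 1
    · have h1 := Nat.find_spec h
      have h2 : R e = Nat.find h + 1 := dif_pos h
      rw [h2]
      refine ⟨by omega, by omega, fun _ => ⟨by simpa using h1.2, fun m hm hlt heq => ?_⟩⟩
      exact Nat.find_min h (by simpa using hlt) ⟨hm, heq⟩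
    · have h2 : R e = 1 := dif_neg h
      rw [h2]
      exact ⟨le_rfl, fun _ m hm heq => h ⟨m, hm, heq⟩, by omega⟩
  have hT : ∀ e m, 1 ≤ T e m ∧ (T e m = 1 → ∀ s, ¬ HaltsWithin e m s) ∧
      (2 ≤ T e m → HaltsWithin e m (T e m - 2) ∧ ∀ s < T e m - 2, ¬ HaltsWithin e m s) := by
    intro e m
    by_cases h : ∃ s, HaltsWithin e m s
    · have h2 : T e m = Nat.find h + 2 := dif_pos h
      rw [h2]
      exact ⟨by omega, by omega, fun _ => ⟨Nat.find_spec h, fun s hs => Nat.find_min h hs⟩⟩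
    · have h2 : T e m = 1 := dif_neg h
      rw [h2]
      exact ⟨le_rfl, fun _ s hs => h ⟨s, hs⟩, by omega⟩
  refine ⟨X, fun i j => ⟨?_, fun hi hj hj1 => ?_, fun hi => ?_⟩⟩
  · by_cases hi : i.unpair.2 = 0
    · simpa [X, hi] using (hR _).1
    · simpa [X, hi] using (hT _ _).1
  · have hXi : X i = R i.unpair.1 := if_pos hi
    have hXj : X j = T i.unpair.1 j.unpair.2 := by simp [X, hj, Nat.one_le_iff_ne_zero.1 hj1]
    rw [hXi, hXj]
    obtain ⟨-, h1, h2⟩ := hR i.unpair.1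
    exact ⟨fun h => h1 h _ hj1, fun h => ⟨fun heq => heq ▸ (h2 h).1, (h2 h).2 _ hj1⟩⟩
  · have hXi : X i = T i.unpair.1 i.unpair.2 := if_neg (by omega)
    rw [hXi]
    obtain ⟨-, h1, h2⟩ := hT i.unpair.1 i.unpair.2
    exact ⟨fun h => h1 h _, fun h => ⟨(h2 h).1, (h2 h).2 _⟩⟩

end Unique

/-! ### Diagonalisation -/

/-- The set of the programs that halt on a whole row of inputs has no `Σ₂` definition. -/
theorem not_sigmaTwo_rows {P : ℕ → ℕ → ℕ → Prop}
    (hP : ComputablePred fun a : (ℕ × ℕ) × ℕ => P a.1.1 a.1.2 a.2) :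
    ¬ ∀ e, (∀ m, 1 ≤ m → ∃ s, HaltsWithin e m s) ↔ ∃ m, ∀ n, P e m n := by
  intro h
  obtain ⟨q, hq, hqP⟩ := ComputablePred.computable_iff.1 hP.not
  replace hqP : ∀ m k n, ¬ P m k n ↔ q ((m, k), n) = true := fun m k n =>
    iff_of_eq (congrFun hqP ((m, k), n))
  -- On input `⟨m, e⟩` the program searches for a counterexample to `P e (m - 1)`; the shift matches
  -- rows that start at `m = 1`. Run on its own number, it halts on the whole row exactly when the
  -- `Σ₂` statement fails.
  have hψ : Nat.Partrec fun a => Nat.rfind fun n =>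
      Part.some (q ((a.unpair.2, a.unpair.1 - 1), n)) := by
    refine Partrec.nat_iff.1 (Partrec.rfind (p := fun (a n : ℕ) =>
      Part.some (q ((a.unpair.2, a.unpair.1 - 1), n))) ?_)
    have ha : Computable fun a : ℕ × ℕ => a.1 := Computable.fst
    exact (hq.comp (((ha.unpair_snd).pair (ha.unpair_fst.sub_fun (Computable.const 1))).pair
      Computable.snd)).partrec
  obtain ⟨c, hc⟩ := Code.exists_code.1 hψ
  have key : ∀ m, (∃ s, HaltsWithin (Encodable.encode c) m s) ↔
      ∃ n, ¬ P (Encodable.encode c) (m - 1) n := by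
    intro m
    rw [exists_haltsWithin_iff, Denumerable.ofNat_encode, hc]
    refine Nat.rfind_dom.trans ?_
    simp [hqP]
  have h' := h (Encodable.encode c)
  simp only [key] at h'
  by_cases hex : ∃ m, ∀ n, P (Encodable.encode c) m n
  · obtain ⟨m, hm⟩ := hex
    obtain ⟨n, hn⟩ := h'.2 ⟨m, hm⟩ (m + 1) (by omega)
    exact hn (hm n)
  · refine hex (h'.1 fun m _ => ?_)
    by_contra! hall
    exact hex ⟨m - 1, hall⟩

/-- The dyadic interval of a finite sequence is decidable on the rational numbers. -/
theorem computablePred_ratEnum_mem_cyl {α : Type*} [Primcodable α] {f : α → ℕ} {g : α → List ℕ}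
    (hf : Computable f) (hg : Computable g) :
    ComputablePred fun a => (ratEnum (f a) : ℝ) ∈ cyl (g a) := by
  have hA := hf.unpair_fst.unpair_fst
  have hB := hf.unpair_fst.unpair_snd
  have hD := hf.unpair_snd.add_fun (Computable.const 1)
  have hc := Computable.fst.comp (computable_cylCode.comp hg)
  have hk := (Computable.const 2).pow_fun (Computable.snd.comp (computable_cylCode.comp hg))
  refine ((ComputablePred.lt ((hB.mul_fun hk).add_fun (hc.mul_fun hD)) (hA.mul_fun hk)).and
    (ComputablePred.lt (hA.mul_fun hk) ((hB.mul_fun hk).add_fun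
      ((hc.add_fun (Computable.const 1)).mul_fun hD)))).of_eq fun a => ?_
  have hpos : (0 : ℝ) < ((f a).unpair.2 : ℝ) + 1 := by positivity
  simp only [cyl, mem_ofPred_eq, ratEnum]
  push_cast
  rw [div_mul_eq_mul_div, lt_div_iff₀ hpos, div_lt_iff₀ hpos, sub_mul, lt_sub_iff_add_lt',
    sub_lt_iff_lt_add']
  norm_cast

/-- A point with a computable system of neighbourhoods that converges to it, in the weak sense of
a decidable family of sets of rational numbers, is not the point addressed by the consistent
sequence. -/
theorem not_exists_computable_approximation {X : ℕ → ℕ}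
    (hX : ∀ i j, Consistent i j (X i) (X j)) {x : ℝ} (hx : ∀ j, x ∈ cyl (initSeg X j))
    {E : ℕ → ℕ → Prop} (hE : ComputablePred fun a : ℕ × ℕ => E a.1 a.2) {h : ℕ → ℕ}
    (hh : Computable h)
    (hcl : ∀ N, ∀ U ∈ 𝓝 x, ∃ n, E N n ∧ (ratEnum (h n) : ℝ) ∈ U)
    (hnhds : ∀ U ∈ 𝓝 x, ∃ N, ∀ n, E N n → (ratEnum (h n) : ℝ) ∈ U) : False := by
  -- This is the `Σ₂` form of `x ∈ cyl σ`. Conversely, points of stage `N` come arbitrarily close to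
  -- `x`, so `x` lies in the closure, and it is no endpoint.
  have hmem : ∀ σ, x ∈ cyl σ ↔ ∃ N, ∀ n, E N n → (ratEnum (h n) : ℝ) ∈ cyl σ := by
    intro σ
    refine ⟨fun hσ => hnhds _ ((isOpen_cyl σ).mem_nhds hσ), ?_⟩
    rintro ⟨N, hN⟩
    refine mem_cyl_of_mem_closure hx (mem_closure_iff_nhds.2 fun U hU => ?_)
    obtain ⟨n, hn, hnU⟩ := hcl N U hU
    exact ⟨_, hnU, hN n hn⟩
  let s : ℕ → List ℕ := fun m => Denumerable.ofNat (List ℕ) m.unpair.1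
  -- The witness `m` codes a pair `(σ, N)`, where `σ` ends with entry `1` at position `⟨e, 0⟩`.
  -- Disjointness of intervals of equal length makes `σ` the true initial segment of `X`.
  refine not_sigmaTwo_rows (P := fun e m n =>
    ((s m).length = Nat.pair e 0 + 1 ∧ (s m).getD (Nat.pair e 0) 0 = 1) ∧
      (E m.unpair.2 n → (ratEnum (h n) : ℝ) ∈ cyl (s m))) ?_ fun e => ?_
  · have he : Computable fun a : (ℕ × ℕ) × ℕ => Nat.pair a.1.1 0 :=
      (Computable.fst.comp Computable.fst).natPair_fun (Computable.const 0)
    have hm : Computable fun a : (ℕ × ℕ) × ℕ => a.1.2 := Computable.snd.comp Computable.fst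
    have hs : Computable fun a : (ℕ × ℕ) × ℕ => s a.1.2 :=
      (Computable.ofNat (List ℕ)).comp hm.unpair_fst
    exact ((ComputablePred.eq (Computable.list_length.comp hs)
      (he.add_fun (Computable.const 1))).and
      (ComputablePred.eq (hs.getD_fun he) (Computable.const 1))).and
      ((hE.comp (hm.unpair_snd.pair Computable.snd)).imp
        (computablePred_ratEnum_mem_cyl (hh.comp Computable.snd) hs))
  · rw [← row_eq_one_iff_of_consistent hX]
    constructor
    · intro h1
      obtain ⟨N, hN⟩ := (hmem _).1 (hx (Nat.pair e 0 + 1))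
      refine ⟨Nat.pair (Encodable.encode (initSeg X (Nat.pair e 0 + 1))) N, fun n => ?_⟩
      simp only [s, Nat.unpair_pair, Denumerable.ofNat_encode, length_initSeg, true_and]
      exact ⟨(getD_initSeg X (Nat.lt_succ_self _)).trans h1, hN n⟩
    · rintro ⟨m, hm⟩
      have hσ : x ∈ cyl (s m) := (hmem _).2 ⟨m.unpair.2, fun n => (hm n).2⟩
      obtain ⟨⟨hl, h1⟩, -⟩ := hm 0
      have := eq_of_mem_cyl ((length_initSeg X _).trans hl.symm) (hx _) hσ
      rwa [← this, getD_initSeg X (Nat.lt_succ_self _)] at h1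

/-! ### Deciding inequalities between coded rationals -/

theorem exists_ratEnum_eq (q : ℚ) : ∃ n, ratEnum n = q := by
  refine ⟨Nat.pair (Nat.pair q.num.toNat (-q.num).toNat) (q.den - 1), ?_⟩
  have h1 : (q.num.toNat : ℚ) - ((-q.num).toNat : ℚ) = q.num := by
    exact_mod_cast Int.toNat_sub_toNat_neg q.num
  have h2 : ((q.den - 1 : ℕ) : ℚ) + 1 = q.den := by
    exact_mod_cast Nat.sub_add_cancel q.den_pos
  simp only [ratEnum, Nat.unpair_pair, h1, h2, Rat.num_div_den]

/-- Truncated subtraction performs the projection at `0` and `min` the one at `1`, so distances to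
centres reduce to arithmetic on natural numbers. -/
theorem coe_unitDense (n : ℕ) :
    (unitDense n : ℝ) = (min (n.unpair.1.unpair.1 - n.unpair.1.unpair.2) (n.unpair.2 + 1) : ℕ) /
      ((n.unpair.2 : ℝ) + 1) := by
  have hd : (0 : ℝ) < (n.unpair.2 : ℝ) + 1 := by positivity
  simp only [unitDense, coe_projIcc, ratEnum]
  push_cast
  generalize n.unpair.1.unpair.1 = a, n.unpair.1.unpair.2 = b
  rw [← min_div_div_right hd.le, div_self hd.ne', min_comm 1]
  rcases le_total a b with h | h
  · have h' : (a : ℝ) ≤ b := by exact_mod_cast h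
    have h3 : ((a : ℝ) - b) / ((n.unpair.2 : ℝ) + 1) ≤ 0 :=
      div_nonpos_of_nonpos_of_nonneg (by linarith) hd.le
    rw [Nat.sub_eq_zero_of_le h, max_eq_left ((min_le_left _ _).trans h3)]
    simp
  · have h' : (b : ℝ) ≤ a := by exact_mod_cast h
    rw [Nat.cast_sub h, max_eq_right]
    exact le_min (div_nonneg (by linarith) hd.le) zero_le_one

theorem computablePred_dist_unitDense_lt {α : Type*} [Primcodable α] {f g : α → ℕ}
    (hf : Computable f) (hg : Computable g) :
    ComputablePred fun a => dist (ratEnum (f a) : ℝ) (unitDense (g a).unpair.1) <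
      (radiusEnum (g a).unpair.2 : ℝ) := by
  have c1 : Computable fun _ : α => 1 := Computable.const 1
  have hA := hf.unpair_fst.unpair_fst
  have hB := hf.unpair_fst.unpair_snd
  have hD := hf.unpair_snd.add_fun c1
  have hd := hg.unpair_fst.unpair_snd.add_fun c1
  have hu := (hg.unpair_fst.unpair_fst.unpair_fst.sub_fun
    hg.unpair_fst.unpair_fst.unpair_snd).min_fun hd
  have hr := hg.unpair_snd.unpair_fst
  have hb := hg.unpair_snd.unpair_snd.add_fun c1
  have hAdb := (hA.mul_fun hd).mul_fun hb
  have hBdb := ((hB.mul_fun hd).add_fun (hu.mul_fun hD)).mul_fun hb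
  have hrDd := hr.mul_fun (hD.mul_fun hd)
  refine ((ComputablePred.lt hAdb (hBdb.add_fun hrDd)).and
    (ComputablePred.lt hBdb (hAdb.add_fun hrDd))).of_eq fun a => ?_
  have hD' : (0 : ℝ) < ((f a).unpair.2 : ℝ) + 1 := by positivity
  have hd' : (0 : ℝ) < ((g a).unpair.1.unpair.2 : ℝ) + 1 := by positivity
  have hb' : (0 : ℝ) < ((g a).unpair.2.unpair.2 : ℝ) + 1 := by positivity
  rw [Real.dist_eq, coe_unitDense, ratEnum, radiusEnum]
  generalize min ((g a).unpair.1.unpair.1.unpair.1 - (g a).unpair.1.unpair.1.unpair.2)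
    ((g a).unpair.1.unpair.2 + 1) = u
  push_cast
  rw [div_sub_div _ _ hD'.ne' hd'.ne', abs_div, abs_of_pos (mul_pos hD' hd'),
    div_lt_div_iff₀ (mul_pos hD' hd') hb', ← abs_of_pos hb', ← abs_mul, abs_lt,
    ← @Nat.cast_lt ℝ, ← @Nat.cast_lt ℝ]
  push_cast
  constructor <;> rintro ⟨h1, h2⟩ <;> constructor <;> nlinarith

theorem computablePred_ratEnum_mem_Ioo {α : Type*} [Primcodable α] {f : α → ℕ}
    (hf : Computable f) : ComputablePred fun a => (ratEnum (f a) : ℝ) ∈ Ioo (-1 : ℝ) 2 := by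
  have hA := hf.unpair_fst.unpair_fst
  have hB := hf.unpair_fst.unpair_snd
  have hD := hf.unpair_snd.add_fun (Computable.const 1)
  refine ((ComputablePred.lt hB (hA.add_fun hD)).and (ComputablePred.lt hA
    (hB.add_fun ((Computable.const 2).mul_fun hD)))).of_eq fun a => ?_
  have hD' : (0 : ℝ) < ((f a).unpair.2 : ℝ) + 1 := by positivity
  rw [mem_Ioo, ratEnum, ← @Nat.cast_lt ℝ, ← @Nat.cast_lt ℝ]
  push_cast
  rw [lt_div_iff₀ hD', div_lt_iff₀ hD']
  constructor <;> rintro ⟨h1, h2⟩ <;> constructor <;> linarith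

theorem computablePred_ratEnum_mem_Icc {α : Type*} [Primcodable α] {f : α → ℕ}
    (hf : Computable f) : ComputablePred fun a => (ratEnum (f a) : ℝ) ∈ Icc (0 : ℝ) 1 := by
  have hA := hf.unpair_fst.unpair_fst
  have hB := hf.unpair_fst.unpair_snd
  have hD := hf.unpair_snd.add_fun (Computable.const 1)
  refine ((ComputablePred.le hB hA).and (ComputablePred.le hA (hB.add_fun hD))).of_eq fun a => ?_
  have hD' : (0 : ℝ) < ((f a).unpair.2 : ℝ) + 1 := by positivity
  rw [mem_Icc, ratEnum, ← @Nat.cast_le ℝ, ← @Nat.cast_le ℝ]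
  push_cast
  rw [le_div_iff₀ hD', div_le_iff₀ hD']
  constructor <;> rintro ⟨h1, h2⟩ <;> constructor <;> linarith

theorem MapClusterPt.of_tendsto_dist {X ι : Type*} [PseudoMetricSpace X] {l : Filter ι}
    {u v : ι → X} {x : X} (h : MapClusterPt x l u)
    (huv : Tendsto (fun n => dist (u n) (v n)) l (𝓝 0)) : MapClusterPt x l v := by
  rw [mapClusterPt_iff_frequently] at h ⊢
  intro s hs
  obtain ⟨ε, hε, hs⟩ := Metric.mem_nhds_iff.1 hs
  refine ((h _ (Metric.ball_mem_nhds x (half_pos hε))).and_eventually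
    (huv.eventually (gt_mem_nhds (half_pos hε)))).mono fun n hn => hs ?_
  rw [Metric.mem_ball] at *
  have := dist_triangle_left (v n) x (u n)
  linarith [hn.1, hn.2]

/-! ### Noncomputability of the singleton -/

section Point

variable {X : ℕ → ℕ} {x : ℝ}

/-- A rational `x` would be computably approximated by the constant sequence. -/
theorem irrational_of_consistent (hX : ∀ i j, Consistent i j (X i) (X j))
    (hx : ∀ j, x ∈ cyl (initSeg X j)) : Irrational x := by
  rintro ⟨q, rfl⟩
  obtain ⟨n, rfl⟩ := exists_ratEnum_eq q
  refine not_exists_computable_approximation hX hx (E := fun _ _ => True) (h := fun _ => n)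
    ((ComputablePred.eq (Computable.const 0) (Computable.const 0)).of_eq fun _ => by simp)
    (Computable.const n) (fun _ U hU => ⟨0, trivial, mem_of_mem_nhds hU⟩)
    fun U hU => ⟨0, fun _ _ => mem_of_mem_nhds hU⟩

theorem accumulationPoints_ne_of_consistent (hX : ∀ i j, Consistent i j (X i) (X j))
    (hx : ∀ j, x ∈ cyl (initSeg X j)) {u : ℕ → ℝ} (hu : IsComputableSeq realDense u) :
    accumulationPoints u ≠ {x} := by
  intro hacc
  have hx01 : x ∈ Ioo (0 : ℝ) 1 := cyl_nil ▸ hx 0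
  obtain ⟨f, hf, hfu⟩ := hu
  -- The diagonal approximations have error at most `2 ^ (-n)`, hence the same accumulation points
  -- as `u`.
  have hf' : Computable fun n => f n n := hf.comp Computable.id Computable.id
  have hlim : Tendsto (fun n => dist (ratEnum (f n n) : ℝ) (u n)) atTop (𝓝 0) :=
    squeeze_zero (fun _ => dist_nonneg) (fun n => hfu n n)
      (tendsto_pow_atTop_nhds_zero_of_lt_one (by norm_num) (by norm_num))
  have hacc' : ∀ y, MapClusterPt y atTop (fun n => (ratEnum (f n n) : ℝ)) ↔ y = x := by
    intro y
    have : MapClusterPt y atTop u ↔ y = x := by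
      rw [← mem_singleton_iff, ← hacc]; rfl
    rw [← this]
    exact ⟨fun h => h.of_tendsto_dist hlim,
      fun h => h.of_tendsto_dist (by simpa only [dist_comm] using hlim)⟩
  -- The sequence may be unbounded; only terms in `(-1, 2)` are kept. Infinitely many of them
  -- outside `U` would accumulate in the compact set `[-1, 2] \ interior U`, away from `x`.
  refine not_exists_computable_approximation hX hx
    (E := fun N n => N ≤ n ∧ (ratEnum (f n n) : ℝ) ∈ Ioo (-1 : ℝ) 2) (h := fun n => f n n)
    ((ComputablePred.le Computable.fst Computable.snd).and
      (computablePred_ratEnum_mem_Ioo (hf'.comp Computable.snd))) hf' ?_ ?_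
  · intro N U hU
    have h := mapClusterPt_iff_frequently.1 ((hacc' x).2 rfl) _
      (inter_mem hU (Ioo_mem_nhds (a := -1) (b := 2) (by linarith [hx01.1]) (by linarith [hx01.2])))
    obtain ⟨n, hn, hnU⟩ := frequently_atTop.1 h N
    exact ⟨n, ⟨hn, hnU.2⟩, hnU.1⟩
  · intro U hU
    by_contra! hcon
    have hfr : ∃ᶠ n in atTop, (ratEnum (f n n) : ℝ) ∈ Icc (-1 : ℝ) 2 \ interior U :=
      frequently_atTop.2 fun N => by
        obtain ⟨n, ⟨hn, hnI⟩, hnU⟩ := hcon N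
        exact ⟨n, hn, Ioo_subset_Icc_self hnI, fun h => hnU (interior_subset h)⟩
    obtain ⟨y, hy, hyc⟩ := (isCompact_Icc.diff isOpen_interior).exists_mapClusterPt_of_frequently hfr
    rw [hacc'] at hyc
    exact hy.2 (hyc ▸ mem_interior_iff_mem_nhds.2 hU)

theorem not_isCoCEClosed_of_consistent (hX : ∀ i j, Consistent i j (X i) (X j))
    (hx : ∀ j, x ∈ cyl (initSeg X j)) (hx01 : x ∈ Icc (0 : ℝ) 1) :
    ¬ IsCoCEClosed unitDense {(⟨x, hx01⟩ : Icc (0 : ℝ) 1)} := by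
  rintro ⟨p, hp, hpx⟩
  have hirr := irrational_of_consistent hX hx
  let B : ℕ → Set ℝ := fun i =>
    Metric.ball (unitDense (p i).unpair.1 : ℝ) (radiusEnum (p i).unpair.2 : ℝ)
  have hB : ∀ y (hy : y ∈ Icc (0 : ℝ) 1), y = x ↔ ∀ i, y ∉ B i := by
    intro y hy
    have : (⟨y, hy⟩ : Icc (0 : ℝ) 1) ∈ negRep unitDense p ↔ y = x := by
      rw [hpx, mem_singleton_iff, Subtype.mk.injEq]
    rw [← this]
    simp [negRep, rationalBall, B, Subtype.dist_eq]
  have hBc : ComputablePred fun a : (ℕ × ℕ) × ℕ => (ratEnum a.1.2 : ℝ) ∉ B a.2 :=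
    (computablePred_dist_unitDense_lt (Computable.snd.comp Computable.fst)
      (hp.comp Computable.snd)).not
  have hBN : ComputablePred fun a : ℕ × ℕ => ∀ i < a.1, (ratEnum a.2 : ℝ) ∉ B i :=
    ComputablePred.forall_lt (p := fun (a : ℕ × ℕ) i => (ratEnum a.2 : ℝ) ∉ B i) hBc Computable.fst
  -- Stage `N` keeps the rationals of `[0, 1]` that avoid the first `N` balls.
  refine not_exists_computable_approximation hX hx
    (E := fun N n => (ratEnum n : ℝ) ∈ Icc (0 : ℝ) 1 ∧ ∀ i < N, (ratEnum n : ℝ) ∉ B i)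
    (h := fun n => n) ?_ Computable.id ?_ ?_
  · exact (computablePred_ratEnum_mem_Icc (f := fun a : ℕ × ℕ => a.2) Computable.snd).and hBN
  · intro N U hU
    -- Irrationality keeps `x` off the boundary spheres, whose points are rational, so whole
    -- neighbourhoods of `x` avoid the first `N` balls.
    have hout : ∀ i ∈ Finset.range N, (Metric.closedBall (unitDense (p i).unpair.1 : ℝ)
        (radiusEnum (p i).unpair.2 : ℝ))ᶜ ∈ 𝓝 x := by
      intro i _
      refine Metric.isClosed_closedBall.isOpen_compl.mem_nhds fun hmem => ?_
      have heq : dist x (unitDense (p i).unpair.1) = (radiusEnum (p i).unpair.2 : ℝ) :=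
        le_antisymm hmem (not_lt.1 ((hB x hx01).1 rfl i))
      obtain ⟨c, hc⟩ : ∃ c : ℚ, (unitDense (p i).unpair.1 : ℝ) = c :=
        ⟨max 0 (min 1 (ratEnum (p i).unpair.1)), by simp [unitDense, coe_projIcc]⟩
      rw [hc, Real.dist_eq, abs_eq (by rw [← heq]; exact abs_nonneg _)] at heq
      rcases heq with h | h
      · exact hirr ⟨c + radiusEnum (p i).unpair.2, by push_cast; linarith⟩
      · exact hirr ⟨c - radiusEnum (p i).unpair.2, by push_cast; linarith⟩
    have hx' : x ∈ Ioo (0 : ℝ) 1 := cyl_nil ▸ hx 0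
    have hV := inter_mem (inter_mem hU (Ioo_mem_nhds hx'.1 hx'.2))
      ((biInter_finset_mem (Finset.range N)).2 hout)
    obtain ⟨-, hy, ⟨q, rfl⟩⟩ := mem_closure_iff_nhds.1 (Rat.denseRange_cast (𝕜 := ℝ) x) _ hV
    obtain ⟨n, rfl⟩ := exists_ratEnum_eq q
    refine ⟨n, ⟨Ioo_subset_Icc_self hy.1.2, fun i hi hmem => ?_⟩, hy.1.1⟩
    exact mem_iInter₂.1 hy.2 i (Finset.mem_range.2 hi) (Metric.ball_subset_closedBall hmem)
  · intro U hU
    -- By compactness finitely many balls cover `[0, 1]` outside `U`; the stage is taken past their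
    -- indices.
    obtain ⟨t, ht⟩ := (isCompact_Icc.diff isOpen_interior).elim_finite_subcover
      (s := Icc (0 : ℝ) 1 \ interior U) B (fun _ => Metric.isOpen_ball) fun y hy => by
        by_contra hy'
        rw [mem_iUnion, not_exists] at hy'
        exact hy.2 ((hB y hy.1).2 hy' ▸ mem_interior_iff_mem_nhds.2 hU)
    refine ⟨t.sup id + 1, fun n hn => ?_⟩
    by_contra hnU
    obtain ⟨i, hi, hmem⟩ := mem_iUnion₂.1 (ht ⟨hn.1, fun h => hnU (interior_subset h)⟩)
    exact hn.2 i (Nat.lt_succ_of_le (Finset.le_sup (f := id) hi)) hmem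

end Point

/-! ### The co-c.e. closed set and the conclusion -/

/-- This keeps the midpoint of a dyadic interval inside `[0, 1]`, so `unitDense` does not move it.
-/
theorem cylCode_fst_add_one_le (σ : List ℕ) : (cylCode σ).1 + 1 ≤ 2 ^ (cylCode σ).2 := by
  induction σ using List.reverseRecOn with
  | nil => simp [cylCode]
  | append_singleton σ n ih =>
    rw [cylCode_concat]
    simp only [cylStep, pow_add _ (cylCode σ).2]
    have : 2 ≤ 2 ^ (n + 1) := by
      rw [pow_succ]; have := Nat.one_le_two_pow (n := n); omega
    calc (cylCode σ).1 * 2 ^ (n + 1) + 1 + 1 ≤ ((cylCode σ).1 + 1) * 2 ^ (n + 1) := by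
          rw [add_one_mul]; omega
      _ ≤ 2 ^ (cylCode σ).2 * 2 ^ (n + 1) := Nat.mul_le_mul_right _ ih

/-- A code of the ball of the unit interval that is given by the dyadic interval `cyl σ`. -/
def cylBall (σ : List ℕ) : ℕ :=
  -- The centre is `(2c + 1) / 2 ^ (k + 1)` and the radius `1 / 2 ^ (k + 1)`; codes store
  -- denominators minus one.
  Nat.pair (Nat.pair (Nat.pair (2 * (cylCode σ).1 + 1) 0) (2 ^ ((cylCode σ).2 + 1) - 1))
    (Nat.pair 1 (2 ^ ((cylCode σ).2 + 1) - 1))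

theorem computable_cylBall : Computable cylBall := by
  have c (n : ℕ) : Computable fun _ : List ℕ => n := Computable.const n
  have hc := Computable.fst.comp computable_cylCode
  have hk := ((c 2).pow_fun ((Computable.snd.comp computable_cylCode).add_fun (c 1))).sub_fun (c 1)
  exact (((((c 2).mul_fun hc).add_fun (c 1)).natPair_fun (c 0)).natPair_fun hk).natPair_fun
    ((c 1).natPair_fun hk)

theorem rationalBall_cylBall (σ : List ℕ) :
    rationalBall unitDense (cylBall σ) = Subtype.val ⁻¹' cyl σ := by
  ext z
  have hle : ((cylCode σ).1 : ℝ) + 1 ≤ 2 ^ (cylCode σ).2 := by exact_mod_cast cylCode_fst_add_one_le σ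
  have hpow : ((2 ^ ((cylCode σ).2 + 1) - 1 : ℕ) : ℝ) + 1 = 2 ^ (cylCode σ).2 * 2 := by
    rw [Nat.cast_sub Nat.one_le_two_pow, pow_succ]; push_cast; ring
  have hpos : (0 : ℝ) < 2 ^ (cylCode σ).2 * 2 := by positivity
  have hmin : min (2 * (cylCode σ).1 + 1 - 0) (2 ^ ((cylCode σ).2 + 1) - 1 + 1) =
      2 * (cylCode σ).1 + 1 := by
    have := cylCode_fst_add_one_le σ
    rw [Nat.sub_add_cancel Nat.one_le_two_pow, pow_succ, min_eq_left] <;> omega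
  rw [rationalBall, Metric.mem_ball, Subtype.dist_eq, Real.dist_eq, coe_unitDense]
  simp only [cylBall, Nat.unpair_pair, radiusEnum, hmin, cyl, mem_preimage, mem_ofPred_eq]
  push_cast
  rw [hpow, lt_div_iff₀ hpos, ← abs_of_pos hpos, ← abs_mul, abs_of_pos hpos, sub_mul,
    div_mul_cancel₀ _ hpos.ne', abs_lt]
  constructor <;> rintro ⟨h1, h2⟩ <;> constructor <;> linarith

open Classical in
/-- A list of balls that removes the inadmissible dyadic intervals from the unit interval. -/
noncomputable def removedBall (n : ℕ) : ℕ :=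
  -- Code `0` has radius `0`, hence is an empty ball that removes nothing.
  if Admissible (Denumerable.ofNat (List ℕ) n) then 0
  else cylBall (Denumerable.ofNat (List ℕ) n)

theorem computable_removedBall : Computable removedBall := by
  classical
  exact (computablePred_admissible.comp (Computable.ofNat (List ℕ))).ite_fun (Computable.const 0)
    (computable_cylBall.comp (Computable.ofNat (List ℕ)))

theorem mem_negRep_removedBall {z : Icc (0 : ℝ) 1} :
    z ∈ negRep unitDense removedBall ↔ ∀ σ, (z : ℝ) ∈ cyl σ → Admissible σ := by
  have h0 : z ∉ rationalBall unitDense 0 := by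
    simp [rationalBall, radiusEnum, Nat.unpair_zero]
  simp only [negRep, mem_compl_iff, mem_iUnion, not_exists]
  constructor
  · intro h σ hσ
    by_contra hadm
    refine h (Encodable.encode σ) ?_
    rw [removedBall, Denumerable.ofNat_encode, if_neg hadm, rationalBall_cylBall]
    exact hσ
  · intro h n
    rw [removedBall]
    split_ifs with hadm
    · exact h0
    · rw [rationalBall_cylBall]
      exact fun hz => hadm (h _ hz)

theorem connectedComponentIn_eq_singleton_of_countable {Y : Type*} [MetricSpace Y] {A : Set Y}
    (hA : A.Countable) {y : Y} (hy : y ∈ A) : connectedComponentIn A y = {y} :=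
  (hA.isTotallyDisconnected _ (connectedComponentIn_subset A y)
    isPreconnected_connectedComponentIn).eq_singleton_of_mem (mem_connectedComponentIn hy)

theorem corollary3p7 :
    ∃ A : Set (Icc (0 : ℝ) 1),
      A.Nonempty ∧ IsCoCEClosed unitDense A ∧ (connectednessComponents A).Countable ∧
      ∃ C ∈ connectednessComponents A,
        ¬ IsCoCEClosed unitDense C ∧
        ¬ ∃ u : ℕ → ℝ, IsComputableSeq realDense u ∧
            accumulationPoints u = (Subtype.val '' C : Set ℝ) := by
  obtain ⟨X, hX⟩ := exists_consistent
  obtain ⟨x, hx⟩ := exists_forall_mem_cyl fun i => (hX i i).1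
  have hx01 : x ∈ Icc (0 : ℝ) 1 := Ioo_subset_Icc_self (cyl_nil ▸ hx 0)
  set A := negRep unitDense removedBall with hAdef
  have hxA : (⟨x, hx01⟩ : Icc (0 : ℝ) 1) ∈ A := by
    refine mem_negRep_removedBall.2 fun σ hσ => ?_
    rw [← eq_of_mem_cyl (length_initSeg X σ.length) (hx _) hσ]
    exact forall_admissible_iff.2 hX _
  -- The rational points of `A`, among them interval endpoints, need no control; an irrational one
  -- has a consistent address and so equals `x`.
  have hA : A.Countable := by
    refine (((countable_range ((↑) : ℚ → ℝ)).insert x).preimage Subtype.val_injective).mono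
      fun z hz => ?_
    by_cases hirr : Irrational (z : ℝ)
    · have hz01 : (z : ℝ) ∈ Ioo (0 : ℝ) 1 :=
        ⟨lt_of_le_of_ne z.2.1 hirr.ne_zero.symm, lt_of_le_of_ne z.2.2 hirr.ne_one⟩
      obtain ⟨Y, hY⟩ := exists_path hirr hz01
      have : Y = X := eq_of_consistent
        (forall_admissible_iff.1 fun j => mem_negRep_removedBall.1 hz _ (hY j)) hX
      exact Or.inl (eq_of_forall_mem_cyl (this ▸ hY) hx)
    · exact Or.inr (not_not.1 hirr)
  refine ⟨A, ⟨_, hxA⟩, ⟨removedBall, computable_removedBall, rfl⟩, ?_, {⟨x, hx01⟩},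
    ⟨_, hxA, (connectedComponentIn_eq_singleton_of_countable hA hxA).symm⟩,
    not_isCoCEClosed_of_consistent hX hx hx01, ?_⟩
  · refine (hA.image (connectedComponentIn A)).mono ?_
    rintro _ ⟨y, hy, rfl⟩
    exact mem_image_of_mem _ hy
  · rintro ⟨u, hu, hacc⟩
    rw [image_singleton] at hacc
    exact accumulationPoints_ne_of_consistent hX hx hu hacc
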